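/- Let $m\ge 2$. For $z=(z',z_m)\in\mathbb C^{m-1}\times\mathbb C$ put $f(z)=\Re z_m-\frac14|z'|^2$, and let $\mathbb CH^m=\{f>0\}$ be the Siegel domain with the complex hyperbolic metric of sectional curvature between $-1$ and $-\frac14$, $$g_z(Z,Z)=4\,\frac{\langle x,x\rangle\langle X,X\rangle-|\langle x,X\rangle|^2}{-\langle x,x\rangle^2},\qquad x=(-1,z',z_m),\quad X=(0,Z',Z_m),$$ where $\langle x,x'\rangle=2(\bar x_0x'_m+\bar x_mx'_0)+\sum_{j=1}^{m-1}\bar x_jx'_j$. Let $\mathbb CH^m_+=\{\Im z_m<0\}\subset\mathbb CH^m$ be the half-space, $B=\{\Im z_m=0\}\subset\mathbb CH^m$ the bisector bounding it, and $\sigma=\{(0,z_m):z_m>0\}\subset B$ its spine. On $B\setminus\sigma$ use the coordinates $(\tau,\rho,y)\in\mathbb R\times\mathbb R_+^*\times S^{2m-3}$ given by $$(z',z_m)=\bigl(2e^{\tau/2}\tanh(\tfrac\rho2)\,y,\;e^\tau\bigr).$$ On $S^{2m-3}\subset\mathbb C^{m-1}$ let $\theta_y(Y)=\Im\bigl(\sum_j\bar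 y_jY_j\bigr)$ be the standard contact form and let $\gamma'$ be the restriction of the standard metric to $\ker\theta$, extended by $0$ on the direction $iy$, i.e. $\gamma'=g_{S^{2m-3}}-\theta^2$. Put $$\vartheta_1=\theta+\frac{\tanh\frac s2}{2\cosh\frac\rho2}\,d\tau,\qquad \vartheta_2=(1+\tanh^2\tfrac s2)\,d\tau+2\,\frac{\sinh^2\frac\rho2}{\cosh\frac\rho2}\tanh(\tfrac s2)\,\theta .$$ Then every point of $\mathbb CH^m$ has a unique nearest point on $B$ for the Riemannian distance (its projection). The signed distance $s\in\mathbb R$ to $B$ (nonnegative on $\mathbb CH^m_+$) together with the coordinates $(\tau,\rho,y)$ of the projection give smooth coordinates with values in $\mathbb R\times\mathbb R\times\mathbb R_+^*\times S^{2m-3}$: the set of points of $\mathbb CH^m$ whose projection is not on $\sigma$ is parametrized smoothly and bijectively by $(s,\tau,\rho,y)$, with $\mathbb CH^m_+$ corresponding to $s>0$. In these coordinates $$g=ds^2+\cosh^4(\tfrac s2)\cosh^2(\tfrac\rho2)\,\vartheta_2^2+\cosh^2(\tfrac s2)\Bigl[d\rho^2+\sinh^2(\rho)\,\vartheta_1^2+4\sinh^2(\tfrac\rho2)\,\gamma'\Bigr].$$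 -/

import Mathlib

open scoped ContDiff

noncomputable section

namespace ComplexHyperbolic

/-- `ℂ^(m-1)` with its standard Hermitian norm. -/
abbrev V (m : ℕ) : Type := EuclideanSpace ℂ (Fin (m - 1))

/-- The affine space `ℂ^m = ℂ^(m-1) × ℂ`, with points `z = ((z₁, …, z_{m-1}), z_m)`. -/
abbrev E (m : ℕ) : Type := V m × ℂ

/-- The Lorentzian Hermitian product on `ℂ^(m+1)`, conjugate-linear in the first variable, whose
quadratic form is `⟨x, x⟩ = 4 Re (x̄₀ x_m) + ∑ |x_j|²`. -/
def herm {m : ℕ} (x x' : ℂ × V m × ℂ) : ℂ :=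
  2 * (starRingEnd ℂ x.1 * x'.2.2 + starRingEnd ℂ x.2.2 * x'.1) + inner ℂ x.2.1 x'.2.1

/-- Homogeneous coordinates `[-1 : z₁ : … : z_m]` of a point of the affine chart. -/
def lift {m : ℕ} (z : E m) : ℂ × V m × ℂ := (-1, z.1, z.2)

/-- The lift to `ℂ^(m+1)` of a tangent vector of the affine chart. -/
def tangentLift {m : ℕ} (Z : E m) : ℂ × V m × ℂ := (0, Z.1, Z.2)

/-- The complex hyperbolic metric (sectional curvature between `-1` and `-1/4`) in the affine
chart, as a quadratic form in the tangent vector `Z` at `z`. -/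
def metric {m : ℕ} (z Z : E m) : ℝ :=
  4 * ((herm (lift z) (lift z)).re * (herm (tangentLift Z) (tangentLift Z)).re
      - ‖herm (lift z) (tangentLift Z)‖ ^ 2) / (-((herm (lift z) (lift z)).re ^ 2))

/-- The defining function `f(z) = Re z_m - (1/4) ∑ |z_j|²`. -/
def defFun {m : ℕ} (z : E m) : ℝ := z.2.re - ‖z.1‖ ^ 2 / 4

/-- Complex hyperbolic space `ℂH^m` as the Siegel domain. -/
def space (m : ℕ) : Set (E m) := {z | 0 < defFun z}

/-- The half-space `ℂH^m_+ = {Im z_m < 0}`. -/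
def halfSpace (m : ℕ) : Set (E m) := {z | z ∈ space m ∧ z.2.im < 0}

/-- The bisector `B = {Im z_m = 0}`. -/
def bisector (m : ℕ) : Set (E m) := {z | z ∈ space m ∧ z.2.im = 0}

/-- The spine `σ = {(0, z_m) : z_m > 0}` of the bisector. -/
def spine (m : ℕ) : Set (E m) := {z | z ∈ bisector m ∧ z.1 = 0}

/-- In the affine chart, `⟨x, x⟩ < 0` is the condition `f > 0`. -/
theorem herm_lift_self {m : ℕ} (z : E m) :
    (herm (lift z) (lift z)).re = -4 * defFun z := by
  have h : (inner ℂ z.1 z.1 : ℂ).re = ‖z.1‖ ^ 2 := by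
    rw [inner_self_eq_norm_sq_to_K]; norm_cast
  simp only [herm, lift, defFun, Complex.add_re, h, Complex.mul_re, Complex.re_ofNat,
    Complex.im_ofNat, Complex.neg_re, Complex.one_re, Complex.conj_re, map_neg, map_one,
    Complex.neg_im, Complex.one_im, Complex.conj_im]
  ring

/-- The length of a path parametrized by `[0, 1]`. -/
def pathLength {m : ℕ} (c : ℝ → E m) : ℝ :=
  ∫ t in (0 : ℝ)..1, Real.sqrt (metric (c t) (deriv c t))

/-- The Riemannian distance of `ℂH^m`: the infimum of the lengths of the `C¹` paths. -/
def hdist {m : ℕ} (p q : E m) : ℝ :=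
  sInf {L | ∃ c : ℝ → E m, ContDiff ℝ 1 c ∧ (∀ t ∈ Set.Icc (0 : ℝ) 1, c t ∈ space m) ∧
    c 0 = p ∧ c 1 = q ∧ L = pathLength c}

/-- The distance from a point to the bisector. -/
def distBisector {m : ℕ} (p : E m) : ℝ := sInf {r | ∃ b ∈ bisector m, r = hdist p b}

/-- The signed distance to the bisector, nonnegative on `ℂH^m_+`. -/
def signedDist {m : ℕ} (p : E m) : ℝ :=
  if p.2.im ≤ 0 then distBisector p else -distBisector p

/-- `b` is a point of the bisector nearest to `p`. -/
def IsProj {m : ℕ} (p b : E m) : Prop :=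
  b ∈ bisector m ∧ ∀ b' ∈ bisector m, hdist p b ≤ hdist p b'

/-- The point of the bisector with coordinates `(τ, ρ, y)`. -/
def bisectorPoint {m : ℕ} (τ ρ : ℝ) (y : V m) : E m :=
  ((2 * Real.exp (τ / 2) * Real.tanh (ρ / 2)) • y, (Real.exp τ : ℂ))

/-- The coordinate domain: `(s, τ, ρ, y)` with `s, τ ∈ ℝ`, `ρ > 0` and `y` in the unit sphere
`S^(2m-3)` of `ℂ^(m-1)`. -/
def coordDomain (m : ℕ) : Set (ℝ × ℝ × ℝ × V m) := {q | 0 < q.2.2.1 ∧ ‖q.2.2.2‖ = 1}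

/-- An open neighbourhood of `coordDomain m` in `ℝ × ℝ × ℝ × ℂ^(m-1)`, which retracts smoothly
onto it by `y ↦ y / ‖y‖`. -/
def coordNhd (m : ℕ) : Set (ℝ × ℝ × ℝ × V m) := {q | 0 < q.2.2.1 ∧ q.2.2.2 ≠ 0}

/-- The standard contact form of the unit sphere of `ℂ^(m-1)` at `y`:
`θ(Y) = Re ⟨i y, Y⟩ = Im ⟨y, Y⟩`, that is `J (dr / r)` for the radial function `r`, where
`(J α)(Y) = -α(i Y)`. -/
def theta {m : ℕ} (y Y : V m) : ℝ := (inner ℂ y Y : ℂ).im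

/-- The standard metric of the sphere restricted to the contact distribution `ker θ`, extended by
zero on the Reeb direction `i y`. -/
def gammaPrime {m : ℕ} (y Y : V m) : ℝ :=
  ‖Y - ((theta y Y : ℂ) * Complex.I) • y‖ ^ 2

/-- `ϑ₁ = θ + tanh(s/2) / (2 cosh(ρ/2)) dτ`, at the point `q = (s, τ, ρ, y)` on the vector
`w = (ds, dτ, dρ, dy)`. -/
def vartheta₁ {m : ℕ} (q w : ℝ × ℝ × ℝ × V m) : ℝ :=
  theta q.2.2.2 w.2.2.2 + Real.tanh (q.1 / 2) / (2 * Real.cosh (q.2.2.1 / 2)) * w.2.1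

/-- `ϑ₂ = (1 + tanh²(s/2)) dτ + 2 (sinh²(ρ/2) / cosh(ρ/2)) tanh(s/2) θ`. -/
def vartheta₂ {m : ℕ} (q w : ℝ × ℝ × ℝ × V m) : ℝ :=
  (1 + Real.tanh (q.1 / 2) ^ 2) * w.2.1
    + 2 * (Real.sinh (q.2.2.1 / 2) ^ 2 / Real.cosh (q.2.2.1 / 2)) * Real.tanh (q.1 / 2)
      * theta q.2.2.2 w.2.2.2

/-- The metric in the coordinates `q = (s, τ, ρ, y)`, as a quadratic form in
`w = (ds, dτ, dρ, dy)`. -/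
def coordMetric {m : ℕ} (q w : ℝ × ℝ × ℝ × V m) : ℝ :=
  w.1 ^ 2 + Real.cosh (q.1 / 2) ^ 4 * Real.cosh (q.2.2.1 / 2) ^ 2 * vartheta₂ q w ^ 2
    + Real.cosh (q.1 / 2) ^ 2 *
      (w.2.2.1 ^ 2 + Real.sinh q.2.2.1 ^ 2 * vartheta₁ q w ^ 2
        + 4 * Real.sinh (q.2.2.1 / 2) ^ 2 * gammaPrime q.2.2.2 w.2.2.2)

end ComplexHyperbolic

end

/-!
In homogeneous coordinates with `⟨x, x⟩ < 0`, the function `cosh² (d/2) = |⟨x, y⟩|² / ⟨x, x⟩⟨y, y⟩`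
determines the distance `d` from `x` to `y`: by the Cauchy-Schwarz inequality in a unitary coframe,
`arcosh` of the function `cosh d` so defined grows along a path at most as fast as its length.

The bisector is met orthogonally by the geodesics `[ξ(s)]`, `ξ(s) = cosh (s/2) b + sinh (s/2) n`,
with `⟨b, b⟩ = -4`, `⟨n, n⟩ = 4` and `⟨b, n⟩ = 0`. The vector `n` is chosen so that
`Re ⟨n, b'⟩ = 0` for every lift `b'` of a point of the bisector with real outer coordinates.
Hence `|⟨ξ(s), b'⟩| ≥ cosh (s/2) |Re ⟨b, b'⟩|`; as `(Re ⟨b, b'⟩)² ≥ ⟨b, b⟩⟨b', b'⟩` with equality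
only for `b' ∈ ℝ b`, the point `[b]` is the nearest one of the bisector, at distance `|s|`. The
metric is `Re ⟨dξ, dξ⟩ + |⟨ξ, dξ⟩|² / 4`, expanded in these coordinates.
-/

noncomputable section

namespace ComplexHyperbolic

variable {m : ℕ}

section HermitianForm

theorem herm_add_left (x y z : ℂ × V m × ℂ) : herm (x + y) z = herm x z + herm y z := by
  simp only [herm, Prod.fst_add, Prod.snd_add, map_add, inner_add_left]
  ring

theorem herm_add_right (x y z : ℂ × V m × ℂ) : herm x (y + z) = herm x y + herm x z := by
  simp only [herm, Prod.fst_add, Prod.snd_add, inner_add_right]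
  ring

theorem herm_smul_left (a : ℂ) (x y : ℂ × V m × ℂ) :
    herm (a • x) y = starRingEnd ℂ a * herm x y := by
  simp only [herm, Prod.smul_fst, Prod.smul_snd, smul_eq_mul, map_mul, inner_smul_left]
  ring

theorem herm_smul_right (a : ℂ) (x y : ℂ × V m × ℂ) : herm x (a • y) = a * herm x y := by
  simp only [herm, Prod.smul_fst, Prod.smul_snd, smul_eq_mul, inner_smul_right]
  ring

theorem conj_herm (x y : ℂ × V m × ℂ) : starRingEnd ℂ (herm x y) = herm y x := by
  simp only [herm, map_add, map_mul, Complex.conj_conj, inner_conj_symm, map_ofNat]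
  ring

theorem ofReal_re_herm_self (x : ℂ × V m × ℂ) : ((herm x x).re : ℂ) = herm x x :=
  Complex.conj_eq_iff_re.1 (conj_herm x x)

/-- The complex hyperbolic metric in homogeneous coordinates: the quadratic form on tangent vectors
to `ℂ^(m+1)` at `x` whose descent to projective space is the metric at `[x]`. -/
def homMetric (x X : ℂ × V m × ℂ) : ℝ :=
  4 * ((herm x x).re * (herm X X).re - ‖herm x X‖ ^ 2) / (-((herm x x).re ^ 2))

theorem ofReal_homMetric (x X : ℂ × V m × ℂ) :
    (homMetric x X : ℂ)
      = 4 * (herm x x * herm X X - herm X x * herm x X) / (-(herm x x ^ 2)) := by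
  have hnorm : ((‖herm x X‖ ^ 2 : ℝ) : ℂ) = herm X x * herm x X := by
    rw [← conj_herm x X, Complex.conj_mul']
    norm_cast
  rw [homMetric]
  push_cast [ofReal_re_herm_self]
  rw [← hnorm]
  norm_cast

theorem homMetric_add_smul_self {x : ℂ × V m × ℂ} (X : ℂ × V m × ℂ) (a : ℂ) :
    homMetric x (X + a • x) = homMetric x X := by
  rw [← Complex.ofReal_inj, ofReal_homMetric, ofReal_homMetric]
  simp only [herm_add_left, herm_add_right, herm_smul_left, herm_smul_right]
  ring

theorem homMetric_smul_smul {a : ℂ} (ha : a ≠ 0) (x X : ℂ × V m × ℂ) :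
    homMetric (a • x) (a • X) = homMetric x X := by
  have ha' : starRingEnd ℂ a ≠ 0 := by simpa using ha
  rw [← Complex.ofReal_inj, ofReal_homMetric, ofReal_homMetric]
  simp only [herm_smul_left, herm_smul_right]
  field_simp

end HermitianForm

section AffineChart

/-- The point of the affine chart with homogeneous coordinates `x`; by junk division it is `0` when
`x` lies in the hyperplane at infinity `x.1 = 0`. -/
def toAffine (x : ℂ × V m × ℂ) : E m := (-x.1)⁻¹ • x.2

theorem lift_toAffine {x : ℂ × V m × ℂ} (hx : x.1 ≠ 0) : lift (toAffine x) = (-x.1)⁻¹ • x := by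
  refine Prod.ext ?_ rfl
  simp [lift, hx, inv_neg]

theorem defFun_toAffine {x : ℂ × V m × ℂ} (hx : x.1 ≠ 0) :
    defFun (toAffine x) = -(herm x x).re / (4 * ‖x.1‖ ^ 2) := by
  have hself : herm (lift (toAffine x)) (lift (toAffine x))
      = ((‖x.1‖ ^ 2)⁻¹ * (herm x x).re : ℝ) := by
    rw [lift_toAffine hx, herm_smul_left, herm_smul_right, ← mul_assoc, Complex.conj_mul',
      ← ofReal_re_herm_self x]
    simp
  have hf := herm_lift_self (toAffine x)
  rw [hself, Complex.ofReal_re] at hf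
  have : ‖x.1‖ ≠ 0 := norm_ne_zero_iff.2 hx
  field_simp at hf ⊢
  linarith

theorem metric_toAffine {x : ℝ → ℂ × V m × ℂ} {X : ℂ × V m × ℂ} {t : ℝ} (hx : HasDerivAt x X t)
    (h0 : (x t).1 ≠ 0) :
    metric (toAffine (x t)) (deriv (fun u => toAffine (x u)) t) = homMetric (x t) X := by
  have hderiv : HasDerivAt (fun u => toAffine (x u))
      ((-(x t).1)⁻¹ • X.2 + (X.1 / (x t).1 ^ 2) • (x t).2) t := by
    have hfst : HasDerivAt (fun u => (x u).1) X.1 t := by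
      simpa using hx.hasFDerivAt.fst.hasDerivAt
    have hsnd : HasDerivAt (fun u => (x u).2) X.2 t := by
      simpa using hx.hasFDerivAt.snd.hasDerivAt
    simpa [toAffine] using (hfst.neg.fun_inv (neg_ne_zero.2 h0)).fun_smul hsnd
  have htangent : tangentLift (deriv (fun u => toAffine (x u)) t)
      = (-(x t).1)⁻¹ • (X + (-(X.1 / (x t).1)) • x t) := by
    rw [hderiv.deriv]
    refine Prod.ext ?_ ?_
    · simp only [tangentLift, Prod.smul_fst, Prod.fst_add, smul_eq_mul]
      field_simp
      ring
    · change (-(x t).1)⁻¹ • X.2 + (X.1 / (x t).1 ^ 2) • (x t).2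
        = (-(x t).1)⁻¹ • (X.2 + (-(X.1 / (x t).1)) • (x t).2)
      rw [smul_add, smul_smul]
      congr 2
      rw [inv_neg, neg_mul_neg, inv_mul_eq_div, div_div, pow_two]
  change homMetric (lift _) _ = _
  rw [lift_toAffine h0, htangent, homMetric_smul_smul (inv_ne_zero (neg_ne_zero.2 h0)),
    homMetric_add_smul_self]

end AffineChart

section Distance

theorem lift_add (z Z : E m) : lift (z + Z) = lift z + tangentLift Z :=
  Prod.ext (by simp [lift, tangentLift]) rfl

theorem herm_tangentLift_tangentLift (Z W : E m) :
    herm (tangentLift Z) (tangentLift W) = inner ℂ Z.1 W.1 := by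
  simp [herm, tangentLift]

theorem herm_lift_self_eq (z : E m) : herm (lift z) (lift z) = -4 * (defFun z : ℂ) := by
  rw [← ofReal_re_herm_self, herm_lift_self]
  push_cast
  rfl

/-- A unitary coframe for the metric at the point `z`: it identifies the tangent space with the
Hermitian space `ℂ^(m-1) ⊕ ℂ`. -/
def frame (z Z : E m) : WithLp 2 (V m × ℂ) :=
  WithLp.toLp 2 ((√(defFun z))⁻¹ • Z.1, herm (lift z) (tangentLift Z) / (2 * defFun z))

theorem inner_frame {z : E m} (hz : z ∈ space m) (Z W : E m) :
    defFun z * inner ℂ (frame z Z) (frame z W)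
      = herm (tangentLift Z) (tangentLift W)
        + herm (tangentLift Z) (lift z) * herm (lift z) (tangentLift W) / (4 * defFun z) := by
  have hf : (0 : ℝ) < defFun z := hz
  have hsqrt : ((√(defFun z) : ℝ) : ℂ) ^ 2 = defFun z := by
    rw [← Complex.ofReal_pow, Real.sq_sqrt hf.le]
  have hne : ((√(defFun z) : ℝ) : ℂ) ≠ 0 := Complex.ofReal_ne_zero.2 (Real.sqrt_pos.2 hf).ne'
  have hconj : starRingEnd ℂ (herm (lift z) (tangentLift Z) / (2 * defFun z))
      = herm (tangentLift Z) (lift z) / (2 * defFun z) := by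
    rw [map_div₀, conj_herm, map_mul, Complex.conj_ofReal, map_ofNat]
  rw [frame, frame, WithLp.prod_inner_apply, herm_tangentLift_tangentLift]
  simp only [← Complex.coe_smul, inner_smul_left, inner_smul_right, RCLike.inner_apply, hconj,
    Complex.conj_ofReal, Complex.ofReal_inv, map_inv₀]
  rw [← hsqrt]
  field_simp
  ring

theorem metric_eq_norm_frame_sq {z : E m} (hz : z ∈ space m) (Z : E m) :
    metric z Z = ‖frame z Z‖ ^ 2 := by
  have hf : (defFun z : ℂ) ≠ 0 := Complex.ofReal_ne_zero.2 (ne_of_gt hz)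
  have hinner := inner_frame hz Z Z
  rw [inner_self_eq_norm_sq_to_K] at hinner
  have hmetric := ofReal_homMetric (lift z) (tangentLift Z)
  rw [herm_lift_self_eq] at hmetric
  change homMetric (lift z) (tangentLift Z) = _
  rw [← Complex.ofReal_inj, hmetric, Complex.ofReal_pow, ← mul_right_inj' hf]
  refine Eq.trans ?_ hinner.symm
  field_simp
  ring

theorem metric_nonneg {z : E m} (hz : z ∈ space m) (Z : E m) : 0 ≤ metric z Z := by
  rw [metric_eq_norm_frame_sq hz]
  positivity

/-- The hyperbolic cosine of the Riemannian distance, expressed by the Hermitian form. -/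
def coshDist (p z : E m) : ℝ := ‖herm (lift p) (lift z)‖ ^ 2 / (8 * defFun p * defFun z) - 1

theorem coshDist_self {p : E m} (hp : p ∈ space m) : coshDist p p = 1 := by
  have hf : defFun p ≠ 0 := ne_of_gt hp
  rw [coshDist, herm_lift_self_eq, norm_mul, mul_pow, Complex.norm_real, Real.norm_eq_abs, sq_abs]
  norm_num
  field_simp
  norm_num

theorem metric_sub_eq {p z : E m} (hp : p ∈ space m) (hz : z ∈ space m) :
    metric z (p - z) = 2 * defFun p / defFun z * (coshDist p z - 1) := by
  have hfp : (defFun p : ℂ) ≠ 0 := Complex.ofReal_ne_zero.2 (ne_of_gt hp)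
  have hfz : (defFun z : ℂ) ≠ 0 := Complex.ofReal_ne_zero.2 (ne_of_gt hz)
  have htangent : tangentLift (p - z) = lift p + (-1 : ℂ) • lift z := by
    rw [← add_sub_cancel z p, lift_add]
    simp
  have hnorm : ((‖herm (lift p) (lift z)‖ : ℝ) : ℂ) ^ 2
      = herm (lift z) (lift p) * herm (lift p) (lift z) := by
    rw [← conj_herm (lift p) (lift z), Complex.conj_mul']
  change homMetric (lift z) (tangentLift (p - z)) = _
  rw [← Complex.ofReal_inj, ofReal_homMetric, htangent, coshDist]
  push_cast
  simp only [hnorm, herm_add_left, herm_add_right, herm_smul_left, herm_smul_right,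
    herm_lift_self_eq, map_neg, map_one]
  field_simp
  ring

theorem one_le_coshDist {p z : E m} (hp : p ∈ space m) (hz : z ∈ space m) : 1 ≤ coshDist p z := by
  have hfp : 0 < defFun p := hp
  have hfz : 0 < defFun z := hz
  have h := metric_nonneg hz (p - z)
  rw [metric_sub_eq hp hz] at h
  linarith [nonneg_of_mul_nonneg_right h (by positivity)]

theorem defFun_mul_inner_frame_sub (p : E m) {z : E m} (hz : z ∈ space m) (Z : E m) :
    defFun z * inner ℂ (frame z (p - z)) (frame z Z)
      = herm (lift p) (tangentLift Z)
        + herm (lift p) (lift z) * herm (lift z) (tangentLift Z) / (4 * defFun z) := by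
  have hf : (defFun z : ℂ) ≠ 0 := Complex.ofReal_ne_zero.2 (ne_of_gt hz)
  have hp : lift p = lift z + tangentLift (p - z) := by rw [← lift_add, add_sub_cancel]
  rw [inner_frame hz, hp]
  simp only [herm_add_left, herm_lift_self_eq]
  field_simp
  ring

theorem hasDerivAt_herm {x y : ℝ → ℂ × V m × ℂ} {X Y : ℂ × V m × ℂ} {t : ℝ}
    (hx : HasDerivAt x X t) (hy : HasDerivAt y Y t) :
    HasDerivAt (fun u => herm (x u) (y u)) (herm (x t) Y + herm X (y t)) t := by
  have hcoord : ∀ {z : ℝ → ℂ × V m × ℂ} {Z : ℂ × V m × ℂ}, HasDerivAt z Z t →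
      HasDerivAt (fun u => (z u).1) Z.1 t ∧ HasDerivAt (fun u => (z u).2.1) Z.2.1 t ∧
        HasDerivAt (fun u => (z u).2.2) Z.2.2 t := fun hz => by
    have hsnd := hz.hasFDerivAt.snd
    exact ⟨by simpa using hz.hasFDerivAt.fst.hasDerivAt, by simpa using hsnd.fst.hasDerivAt,
      by simpa using hsnd.snd.hasDerivAt⟩
  obtain ⟨hx₀, hx', hxₘ⟩ := hcoord hx
  obtain ⟨hy₀, hy', hyₘ⟩ := hcoord hy
  refine ((((hx₀.star.mul hyₘ).add (hxₘ.star.mul hy₀)).const_mul 2).add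
    (hx'.inner ℂ hy')).congr_deriv ?_
  simp only [herm, starRingEnd_apply]
  ring

theorem hasDerivAt_lift {c : ℝ → E m} {Z : E m} {t : ℝ} (hc : HasDerivAt c Z t) :
    HasDerivAt (fun u => lift (c u)) (tangentLift Z) t :=
  (hasDerivAt_const t (-1 : ℂ)).prodMk hc

theorem hasDerivAt_defFun {c : ℝ → E m} {Z : E m} {t : ℝ} (hc : HasDerivAt c Z t) :
    HasDerivAt (fun u => defFun (c u)) (-(herm (lift (c t)) (tangentLift Z)).re / 2) t := by
  have hre : HasDerivAt (fun u => (herm (lift (c u)) (lift (c u))).re)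
      (herm (lift (c t)) (tangentLift Z) + herm (tangentLift Z) (lift (c t))).re t :=
    Complex.reCLM.hasFDerivAt.comp_hasDerivAt t
      (hasDerivAt_herm (hasDerivAt_lift hc) (hasDerivAt_lift hc))
  have hconj : (herm (tangentLift Z) (lift (c t))).re = (herm (lift (c t)) (tangentLift Z)).re := by
    rw [← conj_herm, Complex.conj_re]
  simp only [herm_lift_self] at hre
  refine (hre.const_mul (-1 / 4)).congr_deriv ?_ |>.congr_of_eventuallyEq (.of_forall fun u => ?_)
  · rw [Complex.add_re, hconj]
    ring
  · simp only
    ring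

theorem hasDerivAt_coshDist {p : E m} {c : ℝ → E m} {Z : E m} {t : ℝ} (hc : HasDerivAt c Z t)
    (hp : p ∈ space m) (ht : c t ∈ space m) :
    HasDerivAt (fun u => coshDist p (c u))
      (inner ℝ (herm (lift p) (lift (c t)))
        (inner ℂ (frame (c t) (p - c t)) (frame (c t) Z)) / (4 * defFun p)) t := by
  have hfp : defFun p ≠ 0 := ne_of_gt hp
  have hft : defFun (c t) ≠ 0 := ne_of_gt ht
  have hherm : HasDerivAt (fun u => herm (lift p) (lift (c u))) (herm (lift p) (tangentLift Z)) t :=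
    (hasDerivAt_herm (hasDerivAt_const t (lift p)) (hasDerivAt_lift hc)).congr_deriv
      (by simp [herm])
  have hinner : defFun (c t) * inner ℝ (herm (lift p) (lift (c t)))
        (inner ℂ (frame (c t) (p - c t)) (frame (c t) Z))
      = inner ℝ (herm (lift p) (lift (c t))) (herm (lift p) (tangentLift Z))
        + ‖herm (lift p) (lift (c t))‖ ^ 2
          * ((herm (lift (c t)) (tangentLift Z)).re / (4 * defFun (c t))) := by
    rw [← real_inner_smul_right, Complex.real_smul, defFun_mul_inner_frame_sub p ht,
      inner_add_right, mul_div_assoc]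
    congr 1
    rw [Complex.inner, mul_right_comm, Complex.mul_conj', ← Complex.ofReal_pow,
      Complex.re_ofReal_mul]
    norm_cast
    rw [Complex.div_ofReal_re]
  refine ((hherm.norm_sq.div ((hasDerivAt_defFun hc).const_mul (8 * defFun p))
    (by positivity)).sub_const 1).congr_deriv ?_
  rw [eq_div_iff (by positivity), ← mul_right_inj' hft, ← mul_assoc, hinner]
  field_simp
  ring

theorem sq_deriv_coshDist_le {p z : E m} (hp : p ∈ space m) (hz : z ∈ space m) (Z : E m) :
    (inner ℝ (herm (lift p) (lift z)) (inner ℂ (frame z (p - z)) (frame z Z)) / (4 * defFun p)) ^ 2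
      ≤ (coshDist p z ^ 2 - 1) * metric z Z := by
  have hfp : 0 < defFun p := hp
  have hfz : 0 < defFun z := hz
  have hherm : ‖herm (lift p) (lift z)‖ ^ 2 = 8 * defFun p * defFun z * (coshDist p z + 1) := by
    rw [coshDist]
    field_simp
    ring
  have hframe : ‖frame z (p - z)‖ ^ 2 = 2 * defFun p / defFun z * (coshDist p z - 1) := by
    rw [← metric_eq_norm_frame_sq hz, metric_sub_eq hp hz]
  have hCS : |inner ℝ (herm (lift p) (lift z)) (inner ℂ (frame z (p - z)) (frame z Z))|
      ≤ ‖herm (lift p) (lift z)‖ * (‖frame z (p - z)‖ * ‖frame z Z‖) :=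
    (abs_real_inner_le_norm _ _).trans
      (mul_le_mul_of_nonneg_left (norm_inner_le_norm _ _) (norm_nonneg _))
  rw [div_pow, div_le_iff₀ (by positivity), ← sq_abs]
  refine (pow_le_pow_left₀ (abs_nonneg _) hCS 2).trans_eq ?_
  rw [mul_pow, mul_pow, hherm, hframe, metric_eq_norm_frame_sq hz]
  field_simp
  ring

theorem arcosh_sub_arcosh_le_integral {X X' g : ℝ → ℝ} {a b : ℝ} (hab : a ≤ b)
    (hX : ∀ t ∈ Set.Icc a b, HasDerivAt X (X' t) t) (hX1 : ∀ t ∈ Set.Icc a b, 1 ≤ X t)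
    (hg : MeasureTheory.IntegrableOn g (Set.Icc a b)) (hg0 : ∀ t ∈ Set.Icc a b, 0 ≤ g t)
    (hle : ∀ t ∈ Set.Icc a b, X' t ≤ √(X t ^ 2 - 1) * g t) :
    Real.arcosh (X b) - Real.arcosh (X a) ≤ ∫ t in a..b, g t := by
  -- `arcosh` is not differentiable at `1`, so `X` is shifted by a small `ε > 0`.
  have hshift : ∀ ε ∈ Set.Ioi (0 : ℝ),
      Real.arcosh (X b + ε) - Real.arcosh (X a + ε) ≤ ∫ t in a..b, g t := by
    intro ε hε
    have hlt : ∀ t ∈ Set.Icc a b, 1 < X t + ε := fun t ht => by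
      linarith [hX1 t ht, Set.mem_Ioi.1 hε]
    have hder : ∀ t ∈ Set.Icc a b, HasDerivAt (fun u => Real.arcosh (X u + ε))
        ((√((X t + ε) ^ 2 - 1))⁻¹ * X' t) t := fun t ht =>
      HasDerivAt.comp (h₂ := Real.arcosh) t (Real.hasDerivAt_arcosh (hlt t ht))
        ((hX t ht).add_const ε)
    refine intervalIntegral.sub_le_integral_of_hasDeriv_right_of_le hab
      (fun t ht => (hder t ht).continuousAt.continuousWithinAt)
      (fun t ht => (hder t (Set.Ioo_subset_Icc_self ht)).hasDerivWithinAt) hg fun t ht => ?_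
    have ht' := Set.Ioo_subset_Icc_self ht
    have hpos : 0 < √((X t + ε) ^ 2 - 1) := Real.sqrt_pos.2 (by nlinarith [hlt t ht'])
    rw [inv_mul_le_iff₀ hpos]
    refine (hle t ht').trans (mul_le_mul_of_nonneg_right (Real.sqrt_le_sqrt ?_) (hg0 t ht'))
    nlinarith [hX1 t ht', Set.mem_Ioi.1 hε]
  have hlim : ∀ t ∈ Set.Icc a b, Filter.Tendsto (fun ε => Real.arcosh (X t + ε))
      (nhdsWithin 0 (Set.Ioi 0)) (nhds (Real.arcosh (X t))) := fun t ht => by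
    have hcont : ContinuousOn (fun ε => Real.arcosh (X t + ε)) (Set.Ici 0) :=
      Real.continuousOn_arcosh.comp (by fun_prop) fun ε hε => by
        simpa using add_le_add (hX1 t ht) (Set.mem_Ici.1 hε)
    simpa [ContinuousWithinAt] using (hcont 0 Set.self_mem_Ici).mono Set.Ioi_subset_Ici_self
  refine le_of_tendsto ((hlim b ⟨hab, le_rfl⟩).sub (hlim a ⟨le_rfl, hab⟩)) ?_
  filter_upwards [self_mem_nhdsWithin] with ε hε using hshift ε hε

theorem continuousOn_sqrt_metric {c : ℝ → E m} (hc : ContDiff ℝ 1 c) {s : Set ℝ}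
    (hs : ∀ t ∈ s, c t ∈ space m) :
    ContinuousOn (fun t => √(metric (c t) (deriv c t))) s := by
  have : Continuous c := hc.continuous
  have : Continuous (deriv c) := hc.continuous_deriv le_rfl
  unfold metric
  refine ContinuousOn.sqrt (ContinuousOn.div ?_ ?_ fun t ht => ?_)
  · simp only [herm, lift, tangentLift]
    fun_prop
  · simp only [herm, lift]
    fun_prop
  · rw [herm_lift_self]
    simpa using ne_of_gt (hs t ht)

theorem arcosh_coshDist_le_pathLength {c : ℝ → E m} (hc : ContDiff ℝ 1 c)
    (hs : ∀ t ∈ Set.Icc (0 : ℝ) 1, c t ∈ space m) :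
    Real.arcosh (coshDist (c 0) (c 1)) ≤ pathLength c := by
  have h0 : c 0 ∈ space m := hs 0 (by simp)
  have h := arcosh_sub_arcosh_le_integral zero_le_one
    (fun t ht => hasDerivAt_coshDist (hc.differentiable one_ne_zero t).hasDerivAt h0 (hs t ht))
    (fun t ht => one_le_coshDist h0 (hs t ht)) (continuousOn_sqrt_metric hc hs).integrableOn_Icc
    (fun t _ => Real.sqrt_nonneg _) fun t ht => by
      rw [← Real.sqrt_mul (by nlinarith [one_le_coshDist h0 (hs t ht)])]
      exact Real.le_sqrt_of_sq_le (sq_deriv_coshDist_le h0 (hs t ht) _)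
  simpa [coshDist_self h0, pathLength] using h

theorem convex_space : Convex ℝ (space m) := by
  have hconcave : ConcaveOn ℝ Set.univ (defFun : E m → ℝ) := by
    have hnorm : ConvexOn ℝ Set.univ fun z : E m => ‖z.1‖ ^ 2 :=
      ((convexOn_univ_norm.comp_linearMap (LinearMap.fst ℝ (V m) ℂ)).pow
        (fun _ _ => norm_nonneg _) 2)
    have hre : ConcaveOn ℝ Set.univ fun z : E m => z.2.re :=
      (Complex.reLm ∘ₗ LinearMap.snd ℝ (V m) ℂ).concaveOn convex_univ
    refine (hre.sub (hnorm.smul (by norm_num : (0 : ℝ) ≤ 1 / 4))).congr fun z _ => ?_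
    simp only [defFun, Pi.sub_apply, smul_eq_mul]
    ring
  simpa [space] using hconcave.convex_gt 0

theorem arcosh_coshDist_le_hdist {p q : E m} (hp : p ∈ space m) (hq : q ∈ space m) :
    Real.arcosh (coshDist p q) ≤ hdist p q := by
  refine le_csInf ⟨_, AffineMap.lineMap p q, ?_, fun t ht => convex_space.lineMap_mem hp hq ht,
    AffineMap.lineMap_apply_zero p q, AffineMap.lineMap_apply_one p q, rfl⟩ ?_
  · simp only [AffineMap.coe_lineMap, vsub_eq_sub, vadd_eq_add]
    fun_prop
  · rintro L ⟨c, hc, hs, rfl, rfl, rfl⟩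
    exact arcosh_coshDist_le_pathLength hc hs

theorem hdist_le_pathLength {c : ℝ → E m} (hc : ContDiff ℝ 1 c)
    (hs : ∀ t ∈ Set.Icc (0 : ℝ) 1, c t ∈ space m) : hdist (c 0) (c 1) ≤ pathLength c := by
  refine csInf_le ⟨0, ?_⟩ ⟨c, hc, hs, rfl, rfl, rfl⟩
  rintro L ⟨c, -, -, -, -, rfl⟩
  exact intervalIntegral.integral_nonneg zero_le_one fun _ _ => Real.sqrt_nonneg _

end Distance

section FermiChart

/-- The translation of length `2 t` along the spine of the bisector, acting on homogeneous
coordinates. -/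
def spineTranslation (t : ℝ) (x : ℂ × V m × ℂ) : ℂ × V m × ℂ :=
  (Real.exp (-t) * x.1, x.2.1, Real.exp t * x.2.2)

theorem herm_spineTranslation (t : ℝ) (x y : ℂ × V m × ℂ) :
    herm (spineTranslation t x) (spineTranslation t y) = herm x y := by
  have hexp : ((Real.exp (-t) : ℝ) : ℂ) * (Real.exp t : ℝ) = 1 := by
    rw [← Complex.ofReal_mul, ← Real.exp_add]
    simp
  simp only [herm, spineTranslation, map_mul, Complex.conj_ofReal]
  linear_combination 2 * (starRingEnd ℂ x.1 * y.2.2 + starRingEnd ℂ x.2.2 * y.1) * hexp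

theorem herm_neg_conj (A A' B B' : ℂ) (v w : V m) :
    herm (-A, v, starRingEnd ℂ A') (-B, w, starRingEnd ℂ B')
      = inner ℂ v w - 2 * (A' * B + starRingEnd ℂ (A * B')) := by
  simp only [herm, map_neg, map_mul, Complex.conj_conj]
  ring

theorem re_herm_neg_conj_self (A A' : ℂ) (v : V m) :
    (herm (-A, v, starRingEnd ℂ A') (-A, v, starRingEnd ℂ A')).re
      = ‖v‖ ^ 2 - 4 * (A * A').re := by
  have hv : (inner ℂ v v : ℂ).re = ‖v‖ ^ 2 :=
    inner_self_eq_norm_sq (𝕜 := ℂ) v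
  rw [herm_neg_conj, mul_comm A', Complex.add_conj, Complex.sub_re, hv, Complex.re_mul_ofReal]
  simp only [Complex.re_ofNat]
  ring

/-- The homogeneous coordinate `A = cosh(s/2) cosh(ρ/2) + i sinh(s/2)` at time `s` of the normal
geodesic of the bisector issued from its point `(0, ρ, y)`, which is `[-A : 2 cosh(s/2) sinh(ρ/2) y
: Ā]`. -/
def fermiFactor (s ρ : ℝ) : ℂ :=
  ⟨Real.cosh (s / 2) * Real.cosh (ρ / 2), Real.sinh (s / 2)⟩

theorem re_fermiFactor (s ρ : ℝ) :
    (fermiFactor s ρ).re = Real.cosh (s / 2) * Real.cosh (ρ / 2) :=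
  rfl

theorem im_fermiFactor (s ρ : ℝ) : (fermiFactor s ρ).im = Real.sinh (s / 2) :=
  rfl

theorem fermiFactor_zero (ρ : ℝ) : fermiFactor 0 ρ = Real.cosh (ρ / 2) :=
  Complex.ext (by simp [fermiFactor, -Complex.ofReal_cosh])
    (by simp [fermiFactor, -Complex.ofReal_cosh])

theorem fermiFactor_ne_zero (s ρ : ℝ) : fermiFactor s ρ ≠ 0 := fun h => by
  have hre := re_fermiFactor s ρ
  rw [h, Complex.zero_re] at hre
  exact (mul_pos (Real.cosh_pos _) (Real.cosh_pos _)).ne hre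

/-- The lift of the normal geodesic of the bisector issued from `bisectorPoint τ ρ y`, normalized by
`⟨x, x⟩ = -4`, at time `s`, where `q = (s, τ, ρ, y)`. -/
def fermiLift (q : ℝ × ℝ × ℝ × V m) : ℂ × V m × ℂ :=
  spineTranslation (q.2.1 / 2) (-fermiFactor q.1 q.2.2.1,
    (2 * Real.cosh (q.1 / 2) * Real.sinh (q.2.2.1 / 2)) • q.2.2.2,
    starRingEnd ℂ (fermiFactor q.1 q.2.2.1))

theorem fermiLift_fst (q : ℝ × ℝ × ℝ × V m) :
    (fermiLift q).1 = -(Real.exp (-(q.2.1 / 2)) * fermiFactor q.1 q.2.2.1) :=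
  mul_neg _ _

theorem fermiLift_fst_ne_zero (q : ℝ × ℝ × ℝ × V m) : (fermiLift q).1 ≠ 0 := by
  rw [fermiLift_fst, neg_ne_zero]
  exact mul_ne_zero (Complex.ofReal_ne_zero.2 (Real.exp_ne_zero _)) (fermiFactor_ne_zero _ _)

theorem herm_fermiLift_self {q : ℝ × ℝ × ℝ × V m} (hy : ‖q.2.2.2‖ = 1) :
    herm (fermiLift q) (fermiLift q) = -4 := by
  have hre : (herm (fermiLift q) (fermiLift q)).re = -4 := by
    rw [fermiLift, herm_spineTranslation, re_herm_neg_conj_self, norm_smul, hy, mul_one,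
      Real.norm_eq_abs, sq_abs, Complex.mul_re, re_fermiFactor, im_fermiFactor]
    linear_combination (-4 * Real.cosh (q.1 / 2) ^ 2) * Real.cosh_sq (q.2.2.1 / 2)
      - 4 * Real.cosh_sq (q.1 / 2)
  rw [← ofReal_re_herm_self, hre]
  norm_num

/-- The Fermi coordinates of the bisector: `q = (s, τ, ρ, y)` goes to the point at signed distance
`s` on the normal geodesic issued from `bisectorPoint τ ρ y`. -/
def fermiChart (q : ℝ × ℝ × ℝ × V m) : E m := toAffine (fermiLift q)

theorem contDiff_fermiLift {n : WithTop ℕ∞} :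
    ContDiff ℝ n (fermiLift : ℝ × ℝ × ℝ × V m → ℂ × V m × ℂ) := by
  have hofReal : ContDiff ℝ n ((↑) : ℝ → ℂ) := Complex.ofRealCLM.contDiff
  have hconj : ContDiff ℝ n (starRingEnd ℂ) := Complex.conjCLE.contDiff
  have hfactor : ContDiff ℝ n fun q : ℝ × ℝ × ℝ × V m => fermiFactor q.1 q.2.2.1 := by
    simp only [fermiFactor, Complex.mk_eq_add_mul_I]
    fun_prop
  unfold fermiLift spineTranslation
  fun_prop

theorem contDiff_fermiChart {n : WithTop ℕ∞} :
    ContDiff ℝ n (fermiChart : ℝ × ℝ × ℝ × V m → E m) := by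
  have hlift := contDiff_fermiLift (m := m) (n := n)
  exact (hlift.fst.neg.inv fun q => neg_ne_zero.2 (fermiLift_fst_ne_zero q)).smul hlift.snd

theorem defFun_fermiChart {q : ℝ × ℝ × ℝ × V m} (hy : ‖q.2.2.2‖ = 1) :
    defFun (fermiChart q) = (‖(fermiLift q).1‖ ^ 2)⁻¹ := by
  rw [fermiChart, defFun_toAffine (fermiLift_fst_ne_zero q), herm_fermiLift_self hy]
  norm_num
  field_simp

theorem fermiChart_mem_space {q : ℝ × ℝ × ℝ × V m} (hy : ‖q.2.2.2‖ = 1) :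
    fermiChart q ∈ space m := by
  have := norm_pos_iff.2 (fermiLift_fst_ne_zero q)
  change 0 < defFun (fermiChart q)
  rw [defFun_fermiChart hy]
  positivity

theorem fermiChart_snd (q : ℝ × ℝ × ℝ × V m) : (fermiChart q).2
    = Real.exp q.2.1 * (starRingEnd ℂ (fermiFactor q.1 q.2.2.1) / fermiFactor q.1 q.2.2.1) := by
  have hexp : Real.exp q.2.1 = Real.exp (q.2.1 / 2) / Real.exp (-(q.2.1 / 2)) := by
    rw [← Real.exp_sub]
    congr 1
    ring
  change (-(fermiLift q).1)⁻¹ * (Real.exp (q.2.1 / 2) * starRingEnd ℂ (fermiFactor q.1 q.2.2.1)) = _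
  rw [fermiLift_fst, neg_neg, hexp]
  push_cast
  field_simp

theorem fermiChart_zero (τ ρ : ℝ) (y : V m) : fermiChart (0, τ, ρ, y) = bisectorPoint τ ρ y := by
  have hcosh : (Real.cosh (ρ / 2) : ℂ) ≠ 0 := Complex.ofReal_ne_zero.2 (Real.cosh_pos _).ne'
  refine Prod.ext ?_ ?_
  · change (-(fermiLift (0, τ, ρ, y)).1)⁻¹ • (fermiLift (0, τ, ρ, y)).2.1 = _
    rw [fermiLift_fst, fermiFactor_zero, neg_neg, ← Complex.ofReal_mul, ← Complex.ofReal_inv,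
      Complex.coe_smul]
    change _ • (2 * Real.cosh (0 / 2) * Real.sinh (ρ / 2)) • y
      = (2 * Real.exp (τ / 2) * Real.tanh (ρ / 2)) • y
    rw [smul_smul, mul_inv, ← Real.exp_neg, neg_neg, zero_div, Real.cosh_zero,
      Real.tanh_eq_sinh_div_cosh]
    congr 1
    ring
  · rw [fermiChart_snd, fermiFactor_zero, Complex.conj_ofReal, div_self hcosh, mul_one]
    rfl

theorem im_fermiChart_snd (q : ℝ × ℝ × ℝ × V m) : (fermiChart q).2.im
    = -(2 * Real.exp q.2.1 * Real.cosh (q.1 / 2) * Real.cosh (q.2.2.1 / 2)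
      / Complex.normSq (fermiFactor q.1 q.2.2.1) * Real.sinh (q.1 / 2)) := by
  rw [fermiChart_snd, Complex.im_ofReal_mul, Complex.div_im, Complex.conj_re, Complex.conj_im,
    re_fermiFactor, im_fermiFactor]
  ring

theorem im_fermiChart_snd_neg_iff (q : ℝ × ℝ × ℝ × V m) : (fermiChart q).2.im < 0 ↔ 0 < q.1 := by
  have hnorm := Complex.normSq_pos.2 (fermiFactor_ne_zero q.1 q.2.2.1)
  rw [im_fermiChart_snd, neg_lt_zero, mul_pos_iff_of_pos_left (by positivity), Real.sinh_pos_iff,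
    div_pos_iff_of_pos_right two_pos]

theorem im_fermiChart_snd_nonpos_iff (q : ℝ × ℝ × ℝ × V m) :
    (fermiChart q).2.im ≤ 0 ↔ 0 ≤ q.1 := by
  have hnorm := Complex.normSq_pos.2 (fermiFactor_ne_zero q.1 q.2.2.1)
  rw [im_fermiChart_snd, neg_nonpos, mul_nonneg_iff_of_pos_left (by positivity),
    Real.sinh_nonneg_iff, le_div_iff₀ two_pos, zero_mul]

end FermiChart

section MetricFormula

/-- The differential of `fermiFactor` at `q = (s, τ, ρ, y)` on the vector `w = (ds, dτ, dρ, dy)`. -/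
def fermiFactorDeriv (q w : ℝ × ℝ × ℝ × V m) : ℂ :=
  ⟨(Real.sinh (q.1 / 2) * Real.cosh (q.2.2.1 / 2) * w.1
      + Real.cosh (q.1 / 2) * Real.sinh (q.2.2.1 / 2) * w.2.2.1) / 2,
    Real.cosh (q.1 / 2) * w.1 / 2⟩

/-- The differential of `fermiLift` at `q = (s, τ, ρ, y)` on the vector `w = (ds, dτ, dρ, dy)`. -/
def fermiLiftDeriv (q w : ℝ × ℝ × ℝ × V m) : ℂ × V m × ℂ :=
  spineTranslation (q.2.1 / 2)
    (-(fermiFactorDeriv q w - (w.2.1 / 2 : ℝ) * fermiFactor q.1 q.2.2.1),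
      (Real.sinh (q.1 / 2) * Real.sinh (q.2.2.1 / 2) * w.1
          + Real.cosh (q.1 / 2) * Real.cosh (q.2.2.1 / 2) * w.2.2.1) • q.2.2.2
        + (2 * Real.cosh (q.1 / 2) * Real.sinh (q.2.2.1 / 2)) • w.2.2.2,
      starRingEnd ℂ (fermiFactorDeriv q w + (w.2.1 / 2 : ℝ) * fermiFactor q.1 q.2.2.1))

theorem hasDerivAt_fermiFactor {s ρ : ℝ → ℝ} {q w : ℝ × ℝ × ℝ × V m} {t : ℝ}
    (hs : HasDerivAt s w.1 t) (hρ : HasDerivAt ρ w.2.2.1 t) (hst : s t = q.1)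
    (hρt : ρ t = q.2.2.1) :
    HasDerivAt (fun u => fermiFactor (s u) (ρ u)) (fermiFactorDeriv q w) t := by
  simp only [fermiFactor, Complex.mk_eq_add_mul_I]
  refine (((hs.div_const 2).cosh.mul (hρ.div_const 2).cosh).ofReal_comp.add
    ((hs.div_const 2).sinh.ofReal_comp.mul_const Complex.I)).congr_deriv ?_
  rw [fermiFactorDeriv, hst, hρt, Complex.mk_eq_add_mul_I]
  push_cast
  ring

theorem hasDerivAt_fermiLift (q w : ℝ × ℝ × ℝ × V m) :
    HasDerivAt (fun t : ℝ => fermiLift (q + t • w)) (fermiLiftDeriv q w) 0 := by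
  obtain ⟨s, τ, ρ, y⟩ := q
  obtain ⟨ds, dτ, dρ, dy⟩ := w
  have hline : ∀ a b : ℝ, HasDerivAt (fun t : ℝ => a + t * b) b 0 := fun a b => by
    simpa using ((hasDerivAt_id (0 : ℝ)).mul_const b).const_add a
  have hs := (hline s ds).div_const 2
  have hτ := (hline τ dτ).div_const 2
  have hρ := (hline ρ dρ).div_const 2
  have hy : HasDerivAt (fun t : ℝ => y + t • dy) dy 0 := by
    simpa using ((hasDerivAt_id (0 : ℝ)).smul_const dy).const_add y
  have hA := hasDerivAt_fermiFactor (q := (s, τ, ρ, y)) (w := (ds, dτ, dρ, dy))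
    (hline s ds) (hline ρ dρ) (by simp) (by simp)
  have hAconj : HasDerivAt (fun t : ℝ => starRingEnd ℂ (fermiFactor (s + t * ds) (ρ + t * dρ)))
      (starRingEnd ℂ (fermiFactorDeriv (s, τ, ρ, y) (ds, dτ, dρ, dy))) 0 := hA.star
  refine ((hτ.fun_neg.exp.ofReal_comp.mul hA.fun_neg).prodMk
    ((((hs.cosh.const_mul 2).fun_mul hρ.sinh).smul hy).prodMk
      (hτ.exp.ofReal_comp.mul hAconj))).congr_deriv ?_
  simp only [zero_mul, add_zero, zero_smul, fermiLiftDeriv, spineTranslation, map_add, map_mul,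
    Complex.conj_ofReal]
  refine Prod.ext ?_ (Prod.ext ?_ ?_)
  · push_cast
    ring
  · simp only
    module
  · push_cast
    ring

theorem inner_eq_theta_mul_I {y Y : V m} (hY : (inner ℂ y Y : ℂ).re = 0) :
    (inner ℂ y Y : ℂ) = theta y Y * Complex.I :=
  Complex.ext (by simp [hY]) (by simp [theta])

theorem norm_sq_eq_theta_sq_add_gammaPrime {y Y : V m} (hy : ‖y‖ = 1)
    (hY : (inner ℂ y Y : ℂ).re = 0) : ‖Y‖ ^ 2 = theta y Y ^ 2 + gammaPrime y Y := by
  rw [gammaPrime, norm_sub_sq (𝕜 := ℂ), inner_smul_right, ← inner_conj_symm,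
    inner_eq_theta_mul_I hY, norm_smul, hy]
  simp
  ring

theorem re_herm_fermiLiftDeriv_self {q w : ℝ × ℝ × ℝ × V m} (hy : ‖q.2.2.2‖ = 1)
    (hw : (inner ℂ q.2.2.2 w.2.2.2 : ℂ).re = 0) :
    (herm (fermiLiftDeriv q w) (fermiLiftDeriv q w)).re
      = w.1 ^ 2 + Real.cosh (q.1 / 2) ^ 2 * w.2.2.1 ^ 2
        + (Real.cosh (q.2.2.1 / 2) ^ 2 * Real.cosh (q.1 / 2) ^ 2 - Real.sinh (q.1 / 2) ^ 2)
          * w.2.1 ^ 2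
        + 4 * Real.sinh (q.2.2.1 / 2) ^ 2 * Real.cosh (q.1 / 2) ^ 2 * ‖w.2.2.2‖ ^ 2 := by
  have hnorm : ∀ a b : ℝ, ‖a • q.2.2.2 + b • w.2.2.2‖ ^ 2 = a ^ 2 + b ^ 2 * ‖w.2.2.2‖ ^ 2 :=
    fun a b => by
      rw [norm_add_sq (𝕜 := ℂ), ← Complex.coe_smul, ← Complex.coe_smul, inner_smul_left,
        inner_smul_right, norm_smul, norm_smul, hy]
      simp [hw, mul_pow]
  rw [fermiLiftDeriv, herm_spineTranslation, re_herm_neg_conj_self, hnorm]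
  simp only [fermiFactorDeriv, fermiFactor, Complex.mul_re, Complex.sub_re, Complex.sub_im,
    Complex.add_re, Complex.add_im, Complex.im_ofReal_mul, Complex.ofReal_re,
    Complex.ofReal_im]
  linear_combination w.1 ^ 2 * Real.cosh_sq (q.1 / 2)
    + (Real.cosh (q.1 / 2) ^ 2 * w.2.2.1 ^ 2 - Real.sinh (q.1 / 2) ^ 2 * w.1 ^ 2)
      * Real.cosh_sq (q.2.2.1 / 2)

theorem herm_fermiLift_fermiLiftDeriv {q w : ℝ × ℝ × ℝ × V m} (hy : ‖q.2.2.2‖ = 1)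
    (hw : (inner ℂ q.2.2.2 w.2.2.2 : ℂ).re = 0) :
    herm (fermiLift q) (fermiLiftDeriv q w)
      = (4 * Real.cosh (q.2.2.1 / 2) * Real.cosh (q.1 / 2) * Real.sinh (q.1 / 2) * w.2.1
        + 4 * Real.sinh (q.2.2.1 / 2) ^ 2 * Real.cosh (q.1 / 2) ^ 2 * theta q.2.2.2 w.2.2.2 : ℝ)
          * Complex.I := by
  have hself : (inner ℂ q.2.2.2 q.2.2.2 : ℂ) = 1 := inner_self_eq_one_of_norm_eq_one hy
  rw [fermiLift, fermiLiftDeriv, herm_spineTranslation, herm_neg_conj]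
  simp only [← Complex.coe_smul, inner_add_right, inner_smul_left, inner_smul_right, hself,
    inner_eq_theta_mul_I hw]
  apply Complex.ext <;>
    simp only [fermiFactor, fermiFactorDeriv, Complex.conj_ofReal, Complex.mul_re, Complex.mul_im,
      Complex.sub_re, Complex.sub_im, Complex.add_re, Complex.add_im, Complex.conj_re,
      Complex.conj_im, Complex.ofReal_re, Complex.ofReal_im, Complex.I_re, Complex.I_im,
      Complex.one_re, Complex.one_im, Complex.re_ofNat, Complex.im_ofNat]
  · linear_combination (-2 * Real.cosh (q.1 / 2) * Real.sinh (q.1 / 2) * w.1)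
      * Real.cosh_sq (q.2.2.1 / 2)
  · ring

theorem homMetric_of_herm_self_eq {x : ℂ × V m × ℂ} (hx : herm x x = -4) (X : ℂ × V m × ℂ) :
    homMetric x X = (herm X X).re + ‖herm x X‖ ^ 2 / 4 := by
  rw [homMetric, hx]
  norm_num
  ring

theorem homMetric_fermiLift {q w : ℝ × ℝ × ℝ × V m} (hy : ‖q.2.2.2‖ = 1)
    (hw : (inner ℂ q.2.2.2 w.2.2.2 : ℂ).re = 0) :
    homMetric (fermiLift q) (fermiLiftDeriv q w) = coordMetric q w := by
  rw [homMetric_of_herm_self_eq (herm_fermiLift_self hy), re_herm_fermiLiftDeriv_self hy hw,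
    herm_fermiLift_fermiLiftDeriv hy hw, norm_mul, Complex.norm_I, mul_one, Complex.norm_real,
    Real.norm_eq_abs, sq_abs, norm_sq_eq_theta_sq_add_gammaPrime hy hw]
  have hcosh_s := Real.cosh_sq (q.1 / 2)
  have hcosh_ρ := Real.cosh_sq (q.2.2.1 / 2)
  have hsinh_ρ : Real.sinh q.2.2.1 = 2 * Real.sinh (q.2.2.1 / 2) * Real.cosh (q.2.2.1 / 2) := by
    rw [← Real.sinh_two_mul, mul_div_cancel₀ _ two_ne_zero]
  have hs := (Real.cosh_pos (q.1 / 2)).ne'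
  have hρ := (Real.cosh_pos (q.2.2.1 / 2)).ne'
  rw [coordMetric, vartheta₁, vartheta₂, hsinh_ρ, Real.tanh_eq_sinh_div_cosh]
  field_simp
  linear_combination
    ((Real.sinh (q.1 / 2) * w.2.1) ^ 2
      - (2 * Real.sinh (q.2.2.1 / 2) * Real.cosh (q.1 / 2) * theta q.2.2.2 w.2.2.2) ^ 2) * hcosh_ρ
    + (4 * Real.sinh (q.2.2.1 / 2) ^ 2 * Real.cosh (q.2.2.1 / 2) * Real.cosh (q.1 / 2)
          * Real.sinh (q.1 / 2) * w.2.1 * theta q.2.2.2 w.2.2.2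
        + (2 * Real.sinh (q.2.2.1 / 2) ^ 2 * Real.cosh (q.1 / 2) * theta q.2.2.2 w.2.2.2) ^ 2
        - Real.cosh (q.2.2.1 / 2) ^ 2 * (Real.cosh (q.1 / 2) ^ 2 - Real.sinh (q.1 / 2) ^ 2)
          * w.2.1 ^ 2) * hcosh_s

theorem metric_fderiv_fermiChart {q w : ℝ × ℝ × ℝ × V m} (hy : ‖q.2.2.2‖ = 1)
    (hw : (inner ℂ q.2.2.2 w.2.2.2 : ℂ).re = 0) :
    metric (fermiChart q) (fderiv ℝ fermiChart q w) = coordMetric q w := by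
  have h := metric_toAffine (hasDerivAt_fermiLift q w) (fermiLift_fst_ne_zero _)
  rw [zero_smul, add_zero, homMetric_fermiLift hy hw] at h
  rwa [← (contDiff_fermiChart.differentiable one_ne_zero q).lineDeriv_eq_fderiv]

end MetricFormula

section Projection

theorem coshDist_toAffine {x : ℂ × V m × ℂ} (hx : x.1 ≠ 0) (z : E m) :
    coshDist (toAffine x) z = ‖herm x (lift z)‖ ^ 2 / (-2 * (herm x x).re * defFun z) - 1 := by
  have hx' : ‖x.1‖ ≠ 0 := norm_ne_zero_iff.2 hx
  rw [coshDist, lift_toAffine hx, herm_smul_left, defFun_toAffine hx, norm_mul, RCLike.norm_conj,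
    norm_inv, norm_neg]
  congr 1
  field_simp
  ring

theorem re_herm_lift_lift (p z : E m) :
    (herm (lift p) (lift z)).re = -(2 * (defFun p + defFun z) + ‖p.1 - z.1‖ ^ 2 / 2) := by
  have hnorm := norm_sub_sq (𝕜 := ℂ) p.1 z.1
  simp only [RCLike.re_to_complex] at hnorm
  simp only [hnorm, herm, lift, defFun, map_neg, map_one, Complex.add_re, Complex.mul_re,
    Complex.re_ofNat, Complex.im_ofNat, Complex.neg_re, Complex.neg_im, Complex.one_re,
    Complex.one_im, Complex.conj_re, Complex.conj_im]
  ring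

theorem sq_re_herm_lift_lift_sub (p z : E m) :
    (herm (lift p) (lift z)).re ^ 2 - 16 * defFun p * defFun z
      = 4 * (defFun p - defFun z) ^ 2 + 2 * (defFun p + defFun z) * ‖p.1 - z.1‖ ^ 2
        + (‖p.1 - z.1‖ ^ 2) ^ 2 / 4 := by
  rw [re_herm_lift_lift]
  ring

theorem le_sq_re_herm_lift_lift {p z : E m} (hp : p ∈ space m) (hz : z ∈ space m) :
    16 * defFun p * defFun z ≤ (herm (lift p) (lift z)).re ^ 2 := by
  have hfp : 0 < defFun p := hp
  have hfz : 0 < defFun z := hz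
  rw [← sub_nonneg, sq_re_herm_lift_lift_sub]
  positivity

theorem lt_sq_re_herm_lift_lift {p z : E m} (hp : p ∈ space m) (hz : z ∈ space m)
    (him : p.2.im = z.2.im) (hne : p ≠ z) :
    16 * defFun p * defFun z < (herm (lift p) (lift z)).re ^ 2 := by
  have hfp : 0 < defFun p := hp
  have hfz : 0 < defFun z := hz
  rw [← sub_pos, sq_re_herm_lift_lift_sub]
  obtain hfst | hfst := eq_or_ne p.1 z.1
  · have hre : p.2.re ≠ z.2.re := fun h => hne (Prod.ext hfst (Complex.ext h him))
    have hdefFun : defFun p - defFun z ≠ 0 := by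
      rw [defFun, defFun, hfst, sub_sub_sub_cancel_right]
      exact sub_ne_zero.2 hre
    positivity
  · have := norm_pos_iff.2 (sub_ne_zero.2 hfst)
    positivity

theorem bisectorPoint_mem {τ ρ : ℝ} {y : V m} (hy : ‖y‖ = 1) :
    bisectorPoint τ ρ y ∈ bisector m :=
  ⟨fermiChart_zero τ ρ y ▸ fermiChart_mem_space (q := (0, τ, ρ, y)) hy, Complex.ofReal_im _⟩

theorem defFun_bisectorPoint {τ ρ : ℝ} {y : V m} (hy : ‖y‖ = 1) :
    defFun (bisectorPoint τ ρ y) = ((Real.exp (-(τ / 2)) * Real.cosh (ρ / 2)) ^ 2)⁻¹ := by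
  rw [← fermiChart_zero, defFun_fermiChart (q := (0, τ, ρ, y)) hy, fermiLift_fst,
    fermiFactor_zero, norm_neg, ← Complex.ofReal_mul, Complex.norm_real, Real.norm_eq_abs, sq_abs]

theorem re_herm_fermiLift_lift (q : ℝ × ℝ × ℝ × V m) {b : E m} (hb : b.2.im = 0) :
    (herm (fermiLift q) (lift b)).re
      = Real.cosh (q.1 / 2) * (Real.exp (-(q.2.1 / 2)) * Real.cosh (q.2.2.1 / 2))
        * (herm (lift (bisectorPoint q.2.1 q.2.2.1 q.2.2.2)) (lift b)).re := by
  have hexp : Real.exp q.2.1 = Real.exp (q.2.1 / 2) ^ 2 := by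
    rw [← Real.exp_nat_mul]
    congr 1
    ring
  simp only [herm, fermiLift, spineTranslation, bisectorPoint, fermiFactor, lift, hb, hexp,
    ← Complex.coe_smul, inner_smul_left, Complex.conj_ofReal,
    Complex.add_re, Complex.mul_re, Complex.mul_im, Complex.re_ofNat, Complex.im_ofNat,
    Complex.neg_re, Complex.neg_im, Complex.one_re, Complex.one_im, Complex.conj_re,
    Complex.conj_im, Complex.ofReal_re, Complex.ofReal_im, map_neg, map_one, map_mul,
    Complex.conj_conj, Complex.add_im]
  rw [Real.tanh_eq_sinh_div_cosh, Real.exp_neg]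
  field_simp
  ring

theorem le_coshDist_fermiChart_add_one {q : ℝ × ℝ × ℝ × V m} (hy : ‖q.2.2.2‖ = 1) {b : E m}
    (hb : b ∈ bisector m) :
    2 * Real.cosh (q.1 / 2) ^ 2
        * ((herm (lift (bisectorPoint q.2.1 q.2.2.1 q.2.2.2)) (lift b)).re ^ 2
          / (16 * defFun (bisectorPoint q.2.1 q.2.2.1 q.2.2.2) * defFun b))
      ≤ coshDist (fermiChart q) b + 1 := by
  have hfb : 0 < defFun b := hb.1
  have : 0 < Real.exp (-(q.2.1 / 2)) * Real.cosh (q.2.2.1 / 2) := by positivity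
  calc _ = (herm (fermiLift q) (lift b)).re ^ 2 / (8 * defFun b) := by
        rw [re_herm_fermiLift_lift q hb.2, defFun_bisectorPoint hy]
        field_simp
        ring
    _ ≤ ‖herm (fermiLift q) (lift b)‖ ^ 2 / (8 * defFun b) := by
        rw [← sq_abs]
        gcongr
        exact Complex.abs_re_le_norm _
    _ = coshDist (fermiChart q) b + 1 := by
        rw [fermiChart, coshDist_toAffine (fermiLift_fst_ne_zero q), herm_fermiLift_self hy]
        norm_num

theorem cosh_add_one (s : ℝ) : Real.cosh s + 1 = 2 * Real.cosh (s / 2) ^ 2 := by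
  have h := Real.cosh_two_mul (s / 2)
  rw [mul_div_cancel₀ _ two_ne_zero, Real.sinh_sq] at h
  linarith

theorem cosh_le_coshDist_fermiChart {q : ℝ × ℝ × ℝ × V m} (hy : ‖q.2.2.2‖ = 1) {b : E m}
    (hb : b ∈ bisector m) : Real.cosh q.1 ≤ coshDist (fermiChart q) b := by
  have hp : bisectorPoint q.2.1 q.2.2.1 q.2.2.2 ∈ space m := (bisectorPoint_mem hy).1
  have hfp : 0 < defFun (bisectorPoint q.2.1 q.2.2.1 q.2.2.2) := hp
  have hfb : 0 < defFun b := hb.1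
  rw [← add_le_add_iff_right 1, cosh_add_one]
  refine le_trans ?_ (le_coshDist_fermiChart_add_one hy hb)
  refine le_mul_of_one_le_right (by positivity) ((one_le_div (by positivity)).2 ?_)
  exact le_sq_re_herm_lift_lift hp hb.1

theorem cosh_lt_coshDist_fermiChart {q : ℝ × ℝ × ℝ × V m} (hy : ‖q.2.2.2‖ = 1) {b : E m}
    (hb : b ∈ bisector m) (hne : bisectorPoint q.2.1 q.2.2.1 q.2.2.2 ≠ b) :
    Real.cosh q.1 < coshDist (fermiChart q) b := by
  have hp := bisectorPoint_mem (τ := q.2.1) (ρ := q.2.2.1) hy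
  have hfp : 0 < defFun (bisectorPoint q.2.1 q.2.2.1 q.2.2.2) := hp.1
  have hfb : 0 < defFun b := hb.1
  rw [← add_lt_add_iff_right 1, cosh_add_one]
  refine lt_of_lt_of_le ?_ (le_coshDist_fermiChart_add_one hy hb)
  refine lt_mul_of_one_lt_right (by positivity) ((one_lt_div (by positivity)).2 ?_)
  exact lt_sq_re_herm_lift_lift hp.1 hb.1 (hp.2.trans hb.2.symm) hne

theorem abs_le_hdist_fermiChart {q : ℝ × ℝ × ℝ × V m} (hy : ‖q.2.2.2‖ = 1) {b : E m}
    (hb : b ∈ bisector m) : |q.1| ≤ hdist (fermiChart q) b := by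
  have hspace := fermiChart_mem_space hy
  refine le_trans ?_ (arcosh_coshDist_le_hdist hspace hb.1)
  rw [← Real.arcosh_cosh (abs_nonneg q.1), Real.cosh_abs, Real.arcosh_le_arcosh (Real.cosh_pos _)
    (one_pos.trans_le (one_le_coshDist hspace hb.1))]
  exact cosh_le_coshDist_fermiChart hy hb

theorem abs_lt_hdist_fermiChart {q : ℝ × ℝ × ℝ × V m} (hy : ‖q.2.2.2‖ = 1) {b : E m}
    (hb : b ∈ bisector m) (hne : bisectorPoint q.2.1 q.2.2.1 q.2.2.2 ≠ b) :
    |q.1| < hdist (fermiChart q) b := by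
  have hspace := fermiChart_mem_space hy
  refine lt_of_lt_of_le ?_ (arcosh_coshDist_le_hdist hspace hb.1)
  rw [← Real.arcosh_cosh (abs_nonneg q.1), Real.cosh_abs, Real.arcosh_lt_arcosh (Real.cosh_pos _)
    (one_pos.trans_le (one_le_coshDist hspace hb.1))]
  exact cosh_lt_coshDist_fermiChart hy hb hne

theorem metric_fderiv_fermiChart_normal {q : ℝ × ℝ × ℝ × V m} (hy : ‖q.2.2.2‖ = 1) (ds : ℝ) :
    metric (fermiChart q) (fderiv ℝ fermiChart q (ds, 0, 0, 0)) = ds ^ 2 := by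
  rw [metric_fderiv_fermiChart hy (by simp)]
  simp [coordMetric, vartheta₁, vartheta₂, theta, gammaPrime]

theorem hdist_fermiChart_le {q : ℝ × ℝ × ℝ × V m} (hy : ‖q.2.2.2‖ = 1) :
    hdist (fermiChart q) (bisectorPoint q.2.1 q.2.2.1 q.2.2.2) ≤ |q.1| := by
  let path (t : ℝ) : ℝ × ℝ × ℝ × V m := ((1 - t) * q.1, q.2)
  have hpath (t : ℝ) : HasDerivAt path (-q.1, 0) t := by
    have hfst : HasDerivAt (fun t : ℝ => (1 - t) * q.1) (-q.1) t := by
      simpa using ((hasDerivAt_id t).const_sub 1).mul_const q.1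
    exact hfst.prodMk (hasDerivAt_const t q.2)
  have hspeed (t : ℝ) :
      √(metric (fermiChart (path t)) (deriv (fermiChart ∘ path) t)) = |q.1| := by
    have hcomp := (contDiff_fermiChart.differentiable one_ne_zero
      (path t)).hasFDerivAt.comp_hasDerivAt t (hpath t)
    rw [hcomp.deriv, Prod.zero_eq_mk, Prod.zero_eq_mk,
      metric_fderiv_fermiChart_normal (q := path t) hy, neg_sq, Real.sqrt_sq_eq_abs]
  have hsmooth : ContDiff ℝ 1 path := by fun_prop
  have hle := hdist_le_pathLength (contDiff_fermiChart.comp hsmooth)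
    fun t _ => fermiChart_mem_space (q := path t) hy
  simp only [pathLength, Function.comp_apply, hspeed] at hle
  rw [← fermiChart_zero]
  simpa [path] using hle

theorem isProj_fermiChart_iff {q : ℝ × ℝ × ℝ × V m} (hy : ‖q.2.2.2‖ = 1) {b : E m} :
    IsProj (fermiChart q) b ↔ b = bisectorPoint q.2.1 q.2.2.1 q.2.2.2 := by
  constructor
  · intro hb
    by_contra hne
    have hlt := abs_lt_hdist_fermiChart hy hb.1 (Ne.symm hne)
    exact (hlt.trans_le (hb.2 _ (bisectorPoint_mem hy))).not_ge (hdist_fermiChart_le hy)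
  · rintro rfl
    exact ⟨bisectorPoint_mem hy,
      fun b hb => (hdist_fermiChart_le hy).trans (abs_le_hdist_fermiChart hy hb)⟩

theorem distBisector_fermiChart {q : ℝ × ℝ × ℝ × V m} (hy : ‖q.2.2.2‖ = 1) :
    distBisector (fermiChart q) = |q.1| := by
  have hb : bisectorPoint q.2.1 q.2.2.1 q.2.2.2 ∈ bisector m := bisectorPoint_mem hy
  have hle : |q.1| ∈ lowerBounds {r | ∃ b ∈ bisector m, r = hdist (fermiChart q) b} := by
    rintro r ⟨b, hb, rfl⟩
    exact abs_le_hdist_fermiChart hy hb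
  exact le_antisymm ((csInf_le ⟨_, hle⟩ ⟨_, hb, rfl⟩).trans (hdist_fermiChart_le hy))
    (le_csInf ⟨_, _, hb, rfl⟩ hle)

theorem signedDist_fermiChart {q : ℝ × ℝ × ℝ × V m} (hy : ‖q.2.2.2‖ = 1) :
    signedDist (fermiChart q) = q.1 := by
  rw [signedDist, distBisector_fermiChart hy]
  split_ifs with him
  · exact abs_of_nonneg ((im_fermiChart_snd_nonpos_iff q).1 him)
  · rw [im_fermiChart_snd_nonpos_iff, not_le] at him
    rw [abs_of_neg him, neg_neg]

end Projection

section Surjectivity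

theorem exists_sq_eq_of_re_pos {w : ℂ} (hw : 0 < w.re) : ∃ η : ℂ, η ^ 2 = w ∧ 0 < η.re := by
  refine ⟨w ^ (2⁻¹ : ℂ), Complex.cpow_ofNat_inv_pow w 2, ?_⟩
  rw [Complex.cpow_inv_two_re]
  positivity

theorem exists_norm_eq_one_smul_eq {𝕜 F : Type*} [RCLike 𝕜] [NormedAddCommGroup F] [NormedSpace 𝕜 F]
    [Nontrivial F] {γ : 𝕜} {v : F} (h : ‖γ‖ = ‖v‖) : ∃ y : F, ‖y‖ = 1 ∧ γ • y = v := by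
  obtain rfl | hγ := eq_or_ne γ 0
  · let := NormedSpace.restrictScalars ℝ 𝕜 F
    rw [norm_zero, eq_comm, norm_eq_zero] at h
    obtain ⟨y, hy⟩ := exists_norm_eq F zero_le_one
    exact ⟨y, hy, by rw [zero_smul, h]⟩
  · refine ⟨γ⁻¹ • v, ?_, smul_inv_smul₀ hγ v⟩
    rw [norm_smul, norm_inv, ← h, inv_mul_cancel₀ (norm_ne_zero_iff.2 hγ)]

theorem exists_fermiFactor_eq {A : ℂ} (hre : 0 < A.re) {r : ℝ} (hr : 0 ≤ r)
    (h : A.re ^ 2 = A.im ^ 2 + 1 + r ^ 2) :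
    ∃ s ρ : ℝ, 0 ≤ ρ ∧ fermiFactor s ρ = A ∧ Real.cosh (s / 2) * Real.sinh (ρ / 2) = r := by
  obtain ⟨s, hs⟩ : ∃ s, Real.sinh (s / 2) = A.im :=
    ⟨2 * Real.arsinh A.im, by rw [mul_div_cancel_left₀ _ two_ne_zero, Real.sinh_arsinh]⟩
  have hcosh := Real.cosh_pos (s / 2)
  obtain ⟨ρ, hρ0, hρ⟩ : ∃ ρ, 0 ≤ ρ ∧ Real.sinh (ρ / 2) = r / Real.cosh (s / 2) :=
    ⟨2 * Real.arsinh (r / Real.cosh (s / 2)),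
      mul_nonneg zero_le_two (Real.arsinh_nonneg_iff.2 (by positivity)),
      by rw [mul_div_cancel_left₀ _ two_ne_zero, Real.sinh_arsinh]⟩
  have hr : Real.cosh (s / 2) * Real.sinh (ρ / 2) = r := by rw [hρ, mul_div_cancel₀ _ hcosh.ne']
  refine ⟨s, ρ, hρ0, Complex.ext ?_ hs, hr⟩
  rw [re_fermiFactor, ← sq_eq_sq₀ (by positivity) hre.le, mul_pow, Real.cosh_sq (ρ / 2), mul_add,
    ← mul_pow, hr, Real.cosh_sq, hs, h]
  ring

theorem fermiChart_two_mul_log_norm {η : ℂ} (hη : η ≠ 0) {k s ρ : ℝ} (hk : k ≠ 0)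
    (hfactor : fermiFactor s ρ = starRingEnd ℂ η / k) (y : V m) :
    fermiChart (s, 2 * Real.log ‖η‖, ρ, y)
      = ((‖η‖ * k / starRingEnd ℂ η * (2 * Real.cosh (s / 2) * Real.sinh (ρ / 2) : ℝ)) • y,
        η ^ 2) := by
  have hnorm : (‖η‖ : ℂ) ≠ 0 := Complex.ofReal_ne_zero.2 (norm_ne_zero_iff.2 hη)
  have hk' : (k : ℂ) ≠ 0 := Complex.ofReal_ne_zero.2 hk
  have hconj : starRingEnd ℂ η ≠ 0 := (map_ne_zero _).2 hη
  have hlog : Real.exp (Real.log ‖η‖) = ‖η‖ := Real.exp_log (norm_pos_iff.2 hη)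
  refine Prod.ext ?_ ?_
  · change (-(fermiLift (s, 2 * Real.log ‖η‖, ρ, y)).1)⁻¹
      • ((2 * Real.cosh (s / 2) * Real.sinh (ρ / 2)) • y) = _
    rw [fermiLift_fst, hfactor, ← Complex.coe_smul, smul_smul, mul_div_cancel_left₀ _ two_ne_zero,
      Real.exp_neg, hlog, neg_neg]
    congr 2
    push_cast
    field_simp
  · rw [fermiChart_snd, hfactor, mul_comm 2, Real.exp_mul, hlog, map_div₀, Complex.conj_conj,
      Complex.conj_ofReal]
    norm_cast
    push_cast
    rw [← Complex.conj_mul']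
    field_simp

theorem exists_fermiChart_eq (hm : 2 ≤ m) {p : E m} (hp : p ∈ space m) :
    ∃ q : ℝ × ℝ × ℝ × V m, 0 ≤ q.2.2.1 ∧ ‖q.2.2.2‖ = 1 ∧ fermiChart q = p := by
  have : Nonempty (Fin (m - 1)) := ⟨⟨0, by omega⟩⟩
  obtain ⟨v, w⟩ := p
  have hf : 0 < defFun (v, w) := hp
  have hdefFun : defFun (v, w) = w.re - ‖v‖ ^ 2 / 4 := rfl
  obtain ⟨η, rfl, hη⟩ := exists_sq_eq_of_re_pos (show 0 < w.re by nlinarith [sq_nonneg ‖v‖])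
  have hη0 : η ≠ 0 := fun h => hη.ne' (h ▸ rfl)
  have : 0 < ‖η‖ := norm_pos_iff.2 hη0
  set k := √(defFun (v, η ^ 2))
  have hk : 0 < k := Real.sqrt_pos.2 hf
  have hsq : (η.re / k) ^ 2 = (-η.im / k) ^ 2 + 1 + (‖v‖ / (2 * k)) ^ 2 := by
    have hk2 : k ^ 2 = defFun (v, η ^ 2) := Real.sq_sqrt hf.le
    rw [hdefFun, pow_two η, Complex.mul_re] at hk2
    field_simp
    linear_combination -4 * hk2
  obtain ⟨s, ρ, hρ, hA, hr⟩ := exists_fermiFactor_eq (A := ⟨η.re / k, -η.im / k⟩)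
    (div_pos hη hk) (by positivity) hsq
  have hfactor : fermiFactor s ρ = starRingEnd ℂ η / k := by
    rw [hA]
    apply Complex.ext <;> simp
  obtain ⟨y, hy, hyv⟩ := exists_norm_eq_one_smul_eq (𝕜 := ℂ) (v := v)
    (γ := ‖η‖ * k / starRingEnd ℂ η * (2 * Real.cosh (s / 2) * Real.sinh (ρ / 2) : ℝ)) (by
      rw [mul_assoc 2, hr, norm_mul, norm_div, norm_mul, RCLike.norm_conj, Complex.norm_real,
        Complex.norm_real, Complex.norm_real, norm_norm, Real.norm_of_nonneg hk.le,
        Real.norm_of_nonneg (by positivity)]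
      field_simp)
  exact ⟨(s, 2 * Real.log ‖η‖, ρ, y), hρ, hy,
    (fermiChart_two_mul_log_norm hη0 hk.ne' hfactor y).trans (by rw [hyv])⟩

end Surjectivity

section Coordinates

theorem bisectorPoint_injective {τ ρ τ' ρ' : ℝ} {y y' : V m} (hρ : 0 < ρ) (hρ' : 0 < ρ')
    (hy : ‖y‖ = 1) (hy' : ‖y'‖ = 1) (h : bisectorPoint τ ρ y = bisectorPoint τ' ρ' y') :
    τ = τ' ∧ ρ = ρ' ∧ y = y' := by
  obtain ⟨hfst, hsnd⟩ := Prod.ext_iff.1 h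
  simp only [bisectorPoint] at hfst hsnd
  obtain rfl : τ = τ' := Real.exp_injective (Complex.ofReal_injective hsnd)
  have hcoeff : ∀ {r : ℝ}, 0 < r → 0 < 2 * Real.exp (τ / 2) * Real.tanh (r / 2) := fun hr => by
    have := Real.sinh_pos_iff.2 (half_pos hr)
    rw [Real.tanh_eq_sinh_div_cosh]
    positivity
  have hnorm := congrArg norm hfst
  rw [norm_smul_of_nonneg (hcoeff hρ).le, norm_smul_of_nonneg (hcoeff hρ').le, hy, hy', mul_one,
    mul_one] at hnorm
  obtain rfl : ρ = ρ' :=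
    (div_left_inj' two_ne_zero).1 (Real.tanh_injective (mul_left_cancel₀ (by positivity) hnorm))
  exact ⟨rfl, rfl, smul_right_injective _ (hcoeff hρ).ne' hfst⟩

theorem bisectorPoint_notMem_spine {τ ρ : ℝ} {y : V m} (hρ : ρ ≠ 0) (hy : y ≠ 0) :
    bisectorPoint τ ρ y ∉ spine m := fun h => by
  have htanh : Real.tanh (ρ / 2) ≠ 0 := by
    rw [Real.tanh_injective.ne_iff' Real.tanh_zero]
    exact div_ne_zero hρ two_ne_zero
  exact smul_ne_zero (mul_ne_zero (by positivity) htanh) hy h.2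

theorem bisectorPoint_zero_mem_spine (τ : ℝ) {y : V m} (hy : ‖y‖ = 1) :
    bisectorPoint τ 0 y ∈ spine m :=
  ⟨bisectorPoint_mem hy, by simp [bisectorPoint]⟩

theorem injOn_fermiChart : Set.InjOn fermiChart (coordDomain m) := by
  rintro ⟨s, τ, ρ, y⟩ ⟨hρ, hy⟩ ⟨s', τ', ρ', y'⟩ ⟨hρ', hy'⟩ h
  obtain rfl : s = s' := by
    have hdist := congrArg signedDist h
    rwa [signedDist_fermiChart hy, signedDist_fermiChart hy'] at hdist
  have hproj := (isProj_fermiChart_iff (q := (s, τ, ρ, y)) hy).2 rfl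
  rw [h, isProj_fermiChart_iff (q := (s, τ', ρ', y')) hy'] at hproj
  obtain ⟨rfl, rfl, rfl⟩ := bisectorPoint_injective hρ hρ' hy hy' hproj
  rfl

theorem bijOn_fermiChart (hm : 2 ≤ m) : Set.BijOn fermiChart (coordDomain m)
    {p | p ∈ space m ∧ ∀ b, IsProj p b → b ∉ spine m} := by
  refine ⟨?_, injOn_fermiChart, ?_⟩
  · rintro q ⟨hρ, hy⟩
    refine ⟨fermiChart_mem_space hy, fun b hb => ?_⟩
    rw [(isProj_fermiChart_iff hy).1 hb]
    exact bisectorPoint_notMem_spine hρ.ne' (norm_ne_zero_iff.1 (hy ▸ one_ne_zero))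
  · rintro p ⟨hp, hproj⟩
    obtain ⟨q, hρ, hy, rfl⟩ := exists_fermiChart_eq hm hp
    refine ⟨q, ⟨hρ.lt_of_ne fun hρ0 => ?_, hy⟩, rfl⟩
    exact hproj _ ((isProj_fermiChart_iff hy).2 rfl) (hρ0 ▸ bisectorPoint_zero_mem_spine _ hy)

theorem existsUnique_isProj (hm : 2 ≤ m) {p : E m} (hp : p ∈ space m) : ∃! b : E m, IsProj p b := by
  obtain ⟨q, -, hy, rfl⟩ := exists_fermiChart_eq hm hp
  simp only [isProj_fermiChart_iff hy, existsUnique_eq]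

theorem fermiChart_mem_halfSpace_iff {q : ℝ × ℝ × ℝ × V m} (hy : ‖q.2.2.2‖ = 1) :
    fermiChart q ∈ halfSpace m ↔ 0 < q.1 :=
  (and_iff_right (fermiChart_mem_space hy)).trans (im_fermiChart_snd_neg_iff q)

end Coordinates

end ComplexHyperbolic

end

open ComplexHyperbolic in
theorem mainTheorem6 (m : ℕ) (hm : 2 ≤ m) :
    -- every point of `ℂH^m` has a unique nearest point on the bisector
    (∀ p ∈ space m, ∃! b : E m, IsProj p b) ∧
    ∃ Φ : ℝ × ℝ × ℝ × V m → E m,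
      -- `Φ` is a smooth parametrization of the points that do not project onto the spine
      ContDiffOn ℝ ∞ Φ (coordNhd m) ∧
      Set.BijOn Φ (coordDomain m) {p | p ∈ space m ∧ ∀ b, IsProj p b → b ∉ spine m} ∧
      -- the half-space is the part `s > 0`
      (∀ q ∈ coordDomain m, Φ q ∈ halfSpace m ↔ 0 < q.1) ∧
      -- `s` is the signed distance to the bisector, `(τ, ρ, y)` the projection onto it
      (∀ q ∈ coordDomain m, signedDist (Φ q) = q.1 ∧
        IsProj (Φ q) (bisectorPoint q.2.1 q.2.2.1 q.2.2.2)) ∧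
      -- the formula for the metric, on the vectors tangent to `ℝ × ℝ × (0, ∞) × S^(2m-3)`
      (∀ q ∈ coordDomain m, ∀ w : ℝ × ℝ × ℝ × V m,
        (inner ℂ q.2.2.2 w.2.2.2 : ℂ).re = 0 →
        metric (Φ q) (fderiv ℝ Φ q w) = coordMetric q w) := by
  exact ⟨fun p hp => existsUnique_isProj hm hp, fermiChart, contDiff_fermiChart.contDiffOn,
    bijOn_fermiChart hm, fun q hq => fermiChart_mem_halfSpace_iff hq.2,
    fun q hq => ⟨signedDist_fermiChart hq.2, (isProj_fermiChart_iff hq.2).2 rfl⟩,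
    fun q hq w hw => metric_fderiv_fermiChart hq.2 hw⟩
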